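/- \textbf{Setting.} Let $M$ be a (Hausdorff, second countable) smooth manifold. A graded manifold $\mathcal M$ with base $M$ is a sheaf $\mathcal O_{\mathcal M}$ of $\mathbb Z$-graded commutative $\mathbb R$-algebras on $M$ that is locally isomorphic to $C^\infty(U)\otimes\widehat{S}V$ for a fixed finite-dimensional $\mathbb Z$-graded vector space $V$; $C^\infty(\mathcal M)$ denotes its algebra of global sections and $\Gamma(T_{\mathcal M})$ the graded derivations of $C^\infty(\mathcal M)$. A dg manifold $(\mathcal M,Q_{\mathcal M})$ is a graded manifold with a vector field $Q_{\mathcal M}$ of degree $+1$ such that $[Q_{\mathcal M},Q_{\mathcal M}]=0$. A dg vector bundle $(\mathcal E,Q_{\mathcal E})$ over it is a graded vector bundle (a sheaf of graded $\mathcal O_{\mathcal M}$-modules that is locally free of finite rank with homogeneous frames) with an operator $Q_{\mathcal E}$ of degree $+1$ on $\Gamma(\mathcal E)$ such that $Q_{\mathcal E}^2=0$ and $Q_{\mathcal E}(fe)=Q_{\mathcal M}(f)e+(-1)^{|f|}fQ_{\mathcal E}(e)$. It is bounded if the degrees of suitable local frames are bounded, uniformly over $M$. Elements of degree $p$ of $\Gamma(T^*_{\mathcal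 M}\otimes\operatorname{End}(\mathcal E))$ are maps $\alpha(X,e)$ of degree $p$ of $X\in\Gamma(T_{\mathcal M})$, $e\in\Gamma(\mathcal E)$ with values in $\Gamma(\mathcal E)$, graded $C^\infty(\mathcal M)$-linear in $X$ and $e$; the differential is $$(D\alpha)(X,e)=Q_{\mathcal E}(\alpha(X,e))-(-1)^{p}\alpha([Q_{\mathcal M},X],e)-(-1)^{p+|X|}\alpha(X,Q_{\mathcal E}(e)).$$ For a linear connection $\nabla$ on $\mathcal E$, the Atiyah cocycle $$\operatorname{At}^{\nabla}_{(\mathcal E,Q_{\mathcal E})}(X,e)=Q_{\mathcal E}(\nabla_Xe)-\nabla_{[Q_{\mathcal M},X]}e-(-1)^{|X|}\nabla_X(Q_{\mathcal E}(e))$$ is a cocycle of degree $1$. The Atiyah class is its class $$\operatorname{At}_{(\mathcal E,Q_{\mathcal E})}=[\operatorname{At}^{\nabla}_{(\mathcal E,Q_{\mathcal E})}]\in H^1(\Gamma(T^*_{\mathcal M}\otimes\operatorname{End}(\mathcal E))),$$ which does not depend on $\nabla$. A contraction from $(\mathcal E,Q_{\mathcal E})$ to $(\mathcal F,Q_{\mathcal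 F})$ is a triple $(\phi,\psi,h)$, where $\phi\colon\mathcal E\to\mathcal F$ and $\psi\colon\mathcal F\to\mathcal E$ are morphisms of dg vector bundles over $\mathcal M$ and $h\colon\mathcal E\to\mathcal E[-1]$ is a bundle map, such that $$\phi\psi=\mathrm{id}_{\mathcal F},\quad \psi\phi=\mathrm{id}_{\mathcal E}+Q_{\mathcal E}h+hQ_{\mathcal E},\quad h^2=0,\quad \phi h=0,\quad h\psi=0.$$ \textbf{Proposition.} Let $(\mathcal E,Q_{\mathcal E})$ and $(\mathcal F,Q_{\mathcal F})$ be bounded dg vector bundles over a dg manifold $(\mathcal M,Q_{\mathcal M})$, and let $(\phi,\psi,h)$ be a contraction from $(\mathcal E,Q_{\mathcal E})$ to $(\mathcal F,Q_{\mathcal F})$. Then the map $\mathrm{id}\otimes(\psi^*\otimes\phi)$, that is, $\alpha\mapsto\big((X,v)\mapsto\phi(\alpha(X,\psi(v)))\big)$, induces isomorphisms $$H^k(\Gamma(T^*_{\mathcal M}\otimes\operatorname{End}(\mathcal E)))\longrightarrow H^k(\Gamma(T^*_{\mathcal M}\otimes\operatorname{End}(\mathcal F)))\qquad(k\in\mathbb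 Z),$$ and for $k=1$ it sends $\operatorname{At}_{(\mathcal E,Q_{\mathcal E})}$ to $\operatorname{At}_{(\mathcal F,Q_{\mathcal F})}$: for all linear connections $\nabla^{\mathcal E}$ on $\mathcal E$ and $\nabla^{\mathcal F}$ on $\mathcal F$, the class of $\operatorname{At}^{\nabla^{\mathcal E}}_{(\mathcal E,Q_{\mathcal E})}$ is sent to the class of $\operatorname{At}^{\nabla^{\mathcal F}}_{(\mathcal F,Q_{\mathcal F})}$. -/

import Mathlib

open scoped Manifold ContDiff
open TopologicalSpace

universe u v w

noncomputable section

namespace DGGeom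

/-! ### The local model: formal power series in graded variables

`C^∞(U) ⊗ Ŝ(V)` for a graded vector space `V` with homogeneous basis `ξ_1, …, ξ_r` of degrees
`wt 1, …, wt r`. An element is a formal series `∑ f_a ξ^a` with `f_a` smooth on `U`, where `a` runs
over the multi-indices whose entries at the odd variables are at most `1`. -/

/-- The multi-index `a` is the exponent of a nonzero monomial: odd variables square to zero. -/
def IsAdmissible {r : ℕ} (wt : Fin r → ℤ) (a : Fin r →₀ ℕ) : Prop :=
  ∀ i, Odd (wt i) → a i ≤ 1

/-- The degree of the monomial `ξ^a`. -/
def monomialDegree {r : ℕ} (wt : Fin r → ℤ) (a : Fin r →₀ ℕ) : ℤ :=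
  ∑ i, (a i : ℤ) * wt i

/-- The Koszul sign in `ξ^a * ξ^b = ± ξ^(a+b)`, where `ξ^a = ξ_1^(a_1) ⋯ ξ_r^(a_r)`. -/
def koszulSign {r : ℕ} (wt : Fin r → ℤ) (a b : Fin r →₀ ℕ) : ℝ :=
  (-1 : ℝ) ^ (∑ i, ∑ j, if j < i then ((a i : ℤ) * wt i) * ((b j : ℤ) * wt j) else 0)

section Model

variable {n : ℕ} {M : Type u} [TopologicalSpace M] [ChartedSpace (EuclideanSpace ℝ (Fin n)) M]

/-- Families of smooth functions on `U` indexed by multi-indices. -/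
abbrev ModelSection (n : ℕ) {M : Type u} [TopologicalSpace M]
    [ChartedSpace (EuclideanSpace ℝ (Fin n)) M] (r : ℕ) (U : Opens M) : Type u :=
  (Fin r →₀ ℕ) → C^∞⟮𝓡 n, U; 𝓘(ℝ, ℝ), ℝ⟯

/-- The series that are homogeneous of degree `k`. -/
def modelDeg {r : ℕ} (wt : Fin r → ℤ) (U : Opens M) (k : ℤ) : Set (ModelSection n r U) :=
  {s | ∀ a, s a ≠ 0 → IsAdmissible wt a ∧ monomialDegree wt a = k}

open Classical in
/-- The product of two series. -/
def modelMul {r : ℕ} (wt : Fin r → ℤ) (U : Opens M) (s t : ModelSection n r U) :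
    ModelSection n r U :=
  fun c => if IsAdmissible wt c then
    ∑ p ∈ Finset.HasAntidiagonal.antidiagonal c, koszulSign wt p.1 p.2 • (s p.1 * t p.2) else 0

/-- The unit series. -/
def modelOne (r : ℕ) (U : Opens M) : ModelSection n r U :=
  fun a => if a = 0 then 1 else 0

end Model

/-! ### Graded manifolds and graded vector bundles -/

/-- A sheaf of `ℤ`-graded, graded commutative `ℝ`-algebras on `M`. The algebra `O U` is the direct
sum of its homogeneous parts, and every homogeneous part is a sheaf. -/
structure GradedAlgSheaf (M : Type u) [TopologicalSpace M] where
  O : Opens M → Type v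
  [ring : ∀ U, Ring (O U)]
  [algebra : ∀ U, Algebra ℝ (O U)]
  deg : ∀ U : Opens M, ℤ → Submodule ℝ (O U)
  isInternal : ∀ U, DirectSum.IsInternal (deg U)
  one_mem : ∀ U, (1 : O U) ∈ deg U 0
  mul_mem : ∀ (U : Opens M) (i j : ℤ) (f g : O U),
    f ∈ deg U i → g ∈ deg U j → f * g ∈ deg U (i + j)
  mul_comm : ∀ (U : Opens M) (i j : ℤ) (f g : O U),
    f ∈ deg U i → g ∈ deg U j → f * g = (-1 : ℝ) ^ (i * j) • (g * f)
  res : ∀ {U V : Opens M}, V ≤ U → O U →ₐ[ℝ] O V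
  res_mem : ∀ {U V : Opens M} (h : V ≤ U) (k : ℤ) (f : O U), f ∈ deg U k → res h f ∈ deg V k
  res_self : ∀ (U : Opens M) (f : O U), res (le_refl U) f = f
  res_res : ∀ {U V W : Opens M} (h : V ≤ U) (h' : W ≤ V) (f : O U),
    res h' (res h f) = res (h'.trans h) f
  glue : ∀ {ι : Type u} (U : ι → Opens M) (k : ℤ) (s : ∀ i, O (U i)),
    (∀ i, s i ∈ deg (U i) k) →
    (∀ i j, res (inf_le_left : U i ⊓ U j ≤ U i) (s i)
      = res (inf_le_right : U i ⊓ U j ≤ U j) (s j)) →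
    ∃! t : O (iSup U), t ∈ deg (iSup U) k ∧ ∀ i, res (le_iSup U i) t = s i

attribute [instance] GradedAlgSheaf.ring GradedAlgSheaf.algebra

/-- A graded manifold with base manifold `M`: a sheaf of graded commutative algebras that is locally
isomorphic, as a sheaf of graded algebras, to `U ↦ C^∞(U) ⊗ Ŝ(V)` for one finite-dimensional graded
vector space `V`. A local isomorphism over `U` is a family `e` of linear maps, indexed by the opens
`W ≤ U`, compatible with products, units and restrictions, and bijective in every degree. -/
structure GradedManifold (n : ℕ) (M : Type u) [TopologicalSpace M]
    [ChartedSpace (EuclideanSpace ℝ (Fin n)) M] extends GradedAlgSheaf.{u, v} M where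
  /-- The dimension of `V`. -/
  rank : ℕ
  /-- The degrees of a homogeneous basis of `V`. -/
  wt : Fin rank → ℤ
  locally_trivial : ∀ x : M, ∃ U : Opens M, x ∈ U ∧
    ∃ e : ∀ W : Opens M, O W →ₗ[ℝ] ModelSection n rank W,
      ∀ W, W ≤ U →
        (∀ k, Set.BijOn (e W) (deg W k) (modelDeg wt W k)) ∧
        e W 1 = modelOne rank W ∧
        (∀ f g, e W (f * g) = modelMul wt W (e W f) (e W g)) ∧
        (∀ (W' : Opens M) (h : W' ≤ W) (f : O W) (a : Fin rank →₀ ℕ) (y : W'),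
          e W' (res h f) a y = e W f a ⟨y, h y.2⟩)

section

variable {n : ℕ} {M : Type u} [TopologicalSpace M] [ChartedSpace (EuclideanSpace ℝ (Fin n)) M]

namespace GradedManifold

variable (𝓜 : GradedManifold.{u, v} n M)

/-- The algebra `C^∞(𝓜)` of smooth functions: the global sections of the structure sheaf. -/
abbrev Fn : Type v := 𝓜.O ⊤

/-- Smooth functions of degree `k`. -/
abbrev fnDeg (k : ℤ) : Submodule ℝ 𝓜.Fn := 𝓜.deg ⊤ k

/-- The vector fields of degree `d`, that is, the graded derivations of degree `d` of the algebra of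
smooth functions; `Γ(T_𝓜)` is the direct sum of these spaces. -/
def vectorField (d : ℤ) : Submodule ℝ (Module.End ℝ 𝓜.Fn) where
  carrier := {X | (∀ k f, f ∈ 𝓜.fnDeg k → X f ∈ 𝓜.fnDeg (d + k)) ∧
    ∀ k f g, f ∈ 𝓜.fnDeg k → X (f * g) = X f * g + (-1 : ℝ) ^ (d * k) • (f * X g)}
  add_mem' := by
    rintro X Y ⟨h1, h2⟩ ⟨h3, h4⟩
    refine ⟨fun k f hf => add_mem (h1 k f hf) (h3 k f hf), fun k f g hf => ?_⟩
    simp only [LinearMap.add_apply, h2 k f g hf, h4 k f g hf, add_mul, mul_add, smul_add]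
    abel
  zero_mem' := ⟨fun k f _ => by simp, fun k f g _ => by simp⟩
  smul_mem' := by
    rintro c X ⟨h1, h2⟩
    refine ⟨fun k f hf => Submodule.smul_mem _ c (h1 k f hf), fun k f g hf => ?_⟩
    simp only [LinearMap.smul_apply, h2 k f g hf, smul_add, smul_mul_assoc, mul_smul_comm]
    rw [smul_comm]

end GradedManifold

theorem sign_mul_self (i : ℤ) : (-1 : ℝ) ^ i * (-1 : ℝ) ^ i = 1 := by
  rcases Int.even_or_odd i with h | h <;> simp [h.neg_one_zpow]

theorem sign_add (i j : ℤ) : (-1 : ℝ) ^ (i + j) = (-1 : ℝ) ^ i * (-1 : ℝ) ^ j :=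
  zpow_add₀ (by norm_num) i j

theorem sign_neg (i : ℤ) : (-1 : ℝ) ^ (-i) = (-1 : ℝ) ^ i := by
  rw [zpow_neg]; exact inv_eq_of_mul_eq_one_left (sign_mul_self i)

namespace GradedManifold

variable {𝓜 : GradedManifold.{u, v} n M}

/-- The product `f X` of a function of degree `i` and a vector field of degree `d`. -/
def smulVF {i d : ℤ} {f : 𝓜.Fn} (hf : f ∈ 𝓜.fnDeg i) (X : 𝓜.vectorField d) :
    𝓜.vectorField (i + d) :=
  ⟨LinearMap.mulLeft ℝ f ∘ₗ X.1, by
    obtain ⟨X, h1, h2⟩ := X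
    refine ⟨fun k g hg => ?_, fun k g g' hg => ?_⟩
    · rw [add_assoc]; exact 𝓜.mul_mem _ _ _ _ _ hf (h1 k g hg)
    · simp only [LinearMap.comp_apply, LinearMap.mulLeft_apply, h2 k g g' hg, mul_add,
        mul_smul_comm, ← mul_assoc]
      rw [𝓜.mul_comm _ _ _ f g hf hg, add_mul, sign_add, smul_mul_assoc, smul_smul, mul_comm]⟩

/-- The graded commutator `[X, Y] = X Y - (-1)^(|X| |Y|) Y X` of two vector fields, linear in
`Y`. -/
def bracket {d : ℤ} (X : 𝓜.vectorField d) (d' : ℤ) :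
    𝓜.vectorField d' →ₗ[ℝ] 𝓜.vectorField (d + d') where
  toFun Y := ⟨X.1 ∘ₗ Y.1 - (-1 : ℝ) ^ (d * d') • (Y.1 ∘ₗ X.1), by
    obtain ⟨X, h1, h2⟩ := X
    obtain ⟨Y, h3, h4⟩ := Y
    refine ⟨fun k f hf => ?_, fun k f g hf => ?_⟩
    · have e1 := h1 _ _ (h3 k f hf)
      have e2 := h3 _ _ (h1 k f hf)
      rw [show d + (d' + k) = d + d' + k by ring] at e1
      rw [show d' + (d + k) = d + d' + k by ring] at e2
      exact sub_mem e1 (Submodule.smul_mem _ _ e2)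
    · simp only [LinearMap.sub_apply, LinearMap.smul_apply, LinearMap.comp_apply, h2 k f g hf,
        h4 k f g hf, map_add, map_smul, h2 _ _ g (h3 k f hf), h4 _ _ g (h1 k f hf),
        h2 k f (Y g) hf, h4 k f (X g) hf]
      have s1 := sign_mul_self (d * d')
      have e1 : (-1 : ℝ) ^ (d * (d' + k)) = (-1 : ℝ) ^ (d * d') * (-1 : ℝ) ^ (d * k) := by
        rw [mul_add, sign_add]
      have e2 : (-1 : ℝ) ^ (d' * (d + k)) = (-1 : ℝ) ^ (d * d') * (-1 : ℝ) ^ (d' * k) := by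
        rw [mul_add, sign_add, mul_comm d' d]
      have e3 : (-1 : ℝ) ^ ((d + d') * k) = (-1 : ℝ) ^ (d * k) * (-1 : ℝ) ^ (d' * k) := by
        rw [add_mul, sign_add]
      rw [e1, e2, e3]
      set a := (-1 : ℝ) ^ (d * d')
      set b := (-1 : ℝ) ^ (d * k)
      set c := (-1 : ℝ) ^ (d' * k)
      simp only [smul_add, smul_sub, mul_sub, sub_mul, mul_smul_comm, smul_mul_assoc, smul_smul]
      rw [← mul_assoc a a c, s1]
      module⟩
  map_add' Y Z := by
    ext f
    simp [smul_add]
    abel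
  map_smul' c Y := by
    ext f
    simp [smul_sub, smul_smul, mul_comm]

end GradedManifold

/-- A graded vector bundle over `𝓜`: a sheaf of graded `O`-modules on `M` that is locally free of
finite rank with homogeneous local frames. -/
structure GradedVectorBundle (𝓜 : GradedManifold.{u, v} n M) where
  S : Opens M → Type w
  [addCommGroup : ∀ U, AddCommGroup (S U)]
  [moduleReal : ∀ U, Module ℝ (S U)]
  [module : ∀ U, Module (𝓜.O U) (S U)]
  [tower : ∀ U, IsScalarTower ℝ (𝓜.O U) (S U)]
  deg : ∀ U : Opens M, ℤ → Submodule ℝ (S U)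
  isInternal : ∀ U, DirectSum.IsInternal (deg U)
  smul_mem : ∀ (U : Opens M) (i j : ℤ) (f : 𝓜.O U) (e : S U),
    f ∈ 𝓜.deg U i → e ∈ deg U j → f • e ∈ deg U (i + j)
  res : ∀ {U V : Opens M}, V ≤ U → S U →ₗ[ℝ] S V
  res_smul : ∀ {U V : Opens M} (h : V ≤ U) (f : 𝓜.O U) (e : S U),
    res h (f • e) = 𝓜.res h f • res h e
  res_mem : ∀ {U V : Opens M} (h : V ≤ U) (k : ℤ) (e : S U), e ∈ deg U k → res h e ∈ deg V k
  res_self : ∀ (U : Opens M) (e : S U), res (le_refl U) e = e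
  res_res : ∀ {U V W : Opens M} (h : V ≤ U) (h' : W ≤ V) (e : S U),
    res h' (res h e) = res (h'.trans h) e
  glue : ∀ {ι : Type u} (U : ι → Opens M) (k : ℤ) (s : ∀ i, S (U i)),
    (∀ i, s i ∈ deg (U i) k) →
    (∀ i j, res (inf_le_left : U i ⊓ U j ≤ U i) (s i)
      = res (inf_le_right : U i ⊓ U j ≤ U j) (s j)) →
    ∃! t : S (iSup U), t ∈ deg (iSup U) k ∧ ∀ i, res (le_iSup U i) t = s i
  locally_free : ∀ x : M, ∃ U : Opens M, x ∈ U ∧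
    ∃ (m : ℕ) (p : Fin m → ℤ) (b : Fin m → S U), (∀ a, b a ∈ deg U (p a)) ∧
      ∀ (W : Opens M) (h : W ≤ U), LinearIndependent (𝓜.O W) (fun a => res h (b a)) ∧
        Submodule.span (𝓜.O W) (Set.range fun a => res h (b a)) = ⊤

attribute [instance] GradedVectorBundle.addCommGroup GradedVectorBundle.moduleReal
  GradedVectorBundle.module GradedVectorBundle.tower

namespace GradedVectorBundle

variable {𝓜 : GradedManifold.{u, v} n M}

/-- The bundle is bounded: the degrees of suitable homogeneous local frames are bounded, uniformly
over `M`. -/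
def IsBounded (E : GradedVectorBundle.{u, v, w} 𝓜) : Prop :=
  ∃ N : ℤ, ∀ x : M, ∃ U : Opens M, x ∈ U ∧
    ∃ (m : ℕ) (p : Fin m → ℤ) (b : Fin m → E.S U), (∀ a, |p a| ≤ N) ∧
      (∀ a, b a ∈ E.deg U (p a)) ∧
      ∀ (W : Opens M) (h : W ≤ U), LinearIndependent (𝓜.O W) (fun a => E.res h (b a)) ∧
        Submodule.span (𝓜.O W) (Set.range fun a => E.res h (b a)) = ⊤

/-- The `C^∞(𝓜)`-module `Γ(E)` of global sections. -/
abbrev Sec (E : GradedVectorBundle.{u, v, w} 𝓜) : Type w := E.S ⊤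

/-- Global sections of degree `k`. -/
abbrev secDeg (E : GradedVectorBundle.{u, v, w} 𝓜) (k : ℤ) : Submodule ℝ E.Sec := E.deg ⊤ k

/-- Families of real-bilinear maps `(X, e) ↦ α(X, e)`, where `X` is a homogeneous vector field of
degree `d` (the index of the family) and `e` is a section. -/
abbrev BilinFamily (E : GradedVectorBundle.{u, v, w} 𝓜) : Type (max v w) :=
  ∀ d : ℤ, 𝓜.vectorField d →ₗ[ℝ] Module.End ℝ E.Sec

instance (E : GradedVectorBundle.{u, v, w} 𝓜) : AddCommGroup E.BilinFamily := Pi.addCommGroup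

/-- The elements of degree `p` of `Γ(T^*_𝓜 ⊗ End(E))`: families of degree `p` that are graded
`C^∞(𝓜)`-linear in the vector field and in the section. -/
def endForm (E : GradedVectorBundle.{u, v, w} 𝓜) (p : ℤ) : Submodule ℝ E.BilinFamily where
  carrier := {α |
    (∀ (d : ℤ) (X : 𝓜.vectorField d) (k : ℤ) (e : E.Sec),
      e ∈ E.secDeg k → α d X e ∈ E.secDeg (p + d + k)) ∧
    (∀ (d : ℤ) (X : 𝓜.vectorField d) (i : ℤ) (f : 𝓜.Fn) (hf : f ∈ 𝓜.fnDeg i) (e : E.Sec),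
      α (i + d) (GradedManifold.smulVF hf X) e = (-1 : ℝ) ^ (p * i) • (f • α d X e)) ∧
    (∀ (d : ℤ) (X : 𝓜.vectorField d) (i : ℤ) (f : 𝓜.Fn), f ∈ 𝓜.fnDeg i → ∀ e : E.Sec,
      α d X (f • e) = (-1 : ℝ) ^ ((p + d) * i) • (f • α d X e))}
  add_mem' := by
    rintro α β ⟨a1, a2, a3⟩ ⟨b1, b2, b3⟩
    refine ⟨fun d X k e he => add_mem (a1 d X k e he) (b1 d X k e he),
      fun d X i f hf e => ?_, fun d X i f hf e => ?_⟩
    · simp only [Pi.add_apply, LinearMap.add_apply, a2 d X i f hf e, b2 d X i f hf e, smul_add]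
    · simp only [Pi.add_apply, LinearMap.add_apply, a3 d X i f hf e, b3 d X i f hf e, smul_add]
  zero_mem' := ⟨fun d X k e _ => by simp, fun d X i f hf e => by simp,
    fun d X i f hf e => by simp⟩
  smul_mem' := by
    rintro c α ⟨a1, a2, a3⟩
    refine ⟨fun d X k e he => Submodule.smul_mem _ c (a1 d X k e he),
      fun d X i f hf e => ?_, fun d X i f hf e => ?_⟩
    · simp only [Pi.smul_apply, LinearMap.smul_apply, a2 d X i f hf e]
      rw [smul_comm c, smul_comm c f]
    · simp only [Pi.smul_apply, LinearMap.smul_apply, a3 d X i f hf e]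
      rw [smul_comm c, smul_comm c f]

/-- A linear connection on the graded vector bundle `E`. -/
structure Connection (E : GradedVectorBundle.{u, v, w} 𝓜) where
  /-- `nabla d X e` is `∇_X e` for a vector field `X` of degree `d`. -/
  nabla : E.BilinFamily
  nabla_mem : ∀ (d : ℤ) (X : 𝓜.vectorField d) (k : ℤ) (e : E.Sec),
    e ∈ E.secDeg k → nabla d X e ∈ E.secDeg (d + k)
  nabla_smulVF : ∀ (d : ℤ) (X : 𝓜.vectorField d) (i : ℤ) (f : 𝓜.Fn) (hf : f ∈ 𝓜.fnDeg i)
    (e : E.Sec), nabla (i + d) (GradedManifold.smulVF hf X) e = f • nabla d X e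
  leibniz : ∀ (d : ℤ) (X : 𝓜.vectorField d) (i : ℤ) (f : 𝓜.Fn), f ∈ 𝓜.fnDeg i →
    ∀ e : E.Sec, nabla d X (f • e) = X.1 f • e + (-1 : ℝ) ^ (d * i) • (f • nabla d X e)

end GradedVectorBundle

/-! ### Dg manifolds and dg vector bundles -/

/-- A dg manifold: a graded manifold with a homological vector field. -/
structure DGManifold (n : ℕ) (M : Type u) [TopologicalSpace M]
    [ChartedSpace (EuclideanSpace ℝ (Fin n)) M] extends GradedManifold.{u, v} n M where
  Q : toGradedManifold.vectorField 1
  bracket_self : GradedManifold.bracket Q 1 Q = 0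

/-- A dg vector bundle over `𝓜`: a graded vector bundle with a square-zero operator of degree `1`
on its sections that is a derivation along the homological vector field of `𝓜` (that is, a linear
homological vector field on the total space which projects to that of `𝓜`). -/
structure DGVectorBundle (𝓜 : DGManifold.{u, v} n M)
    extends GradedVectorBundle.{u, v, w} 𝓜.toGradedManifold where
  QE : toGradedVectorBundle.Sec →ₗ[ℝ] toGradedVectorBundle.Sec
  QE_mem : ∀ (k : ℤ) (e : toGradedVectorBundle.Sec),
    e ∈ toGradedVectorBundle.secDeg k → QE e ∈ toGradedVectorBundle.secDeg (k + 1)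
  QE_smul : ∀ (i : ℤ) (f : 𝓜.Fn), f ∈ 𝓜.fnDeg i → ∀ e : toGradedVectorBundle.Sec,
    QE (f • e) = 𝓜.Q.1 f • e + (-1 : ℝ) ^ i • (f • QE e)
  QE_QE : ∀ e, QE (QE e) = 0

namespace DGVectorBundle

variable {𝓜 : DGManifold.{u, v} n M}

/-- The differential on elements of degree `p` of `Γ(T^*_𝓜 ⊗ End(E))`:
`(D α)(X, e) = Q_E(α(X, e)) - (-1)^p α([Q, X], e) - (-1)^(p + |X|) α(X, Q_E e)`. -/
def diff (E : DGVectorBundle.{u, v, w} 𝓜) (p : ℤ) : E.BilinFamily →ₗ[ℝ] E.BilinFamily where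
  toFun α d := LinearMap.mk₂ ℝ
    (fun X e => E.QE (α d X e) - (-1 : ℝ) ^ p • α (1 + d) (GradedManifold.bracket 𝓜.Q d X) e
      - (-1 : ℝ) ^ (p + d) • α d X (E.QE e))
    (by intros; simp only [map_add, LinearMap.add_apply, smul_add]; abel)
    (by intros; simp only [map_smul, LinearMap.smul_apply]; module)
    (by intros; simp only [map_add, smul_add]; abel)
    (by intros; simp only [map_smul]; module)
  map_add' α β := by
    funext d; ext X e
    simp only [LinearMap.mk₂_apply, Pi.add_apply, LinearMap.add_apply, map_add, smul_add]; abel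
  map_smul' c α := by
    funext d; ext X e
    simp only [LinearMap.mk₂_apply, Pi.smul_apply, LinearMap.smul_apply, map_smul,
      RingHom.id_apply]
    module

/-- Cocycles of degree `p` in `Γ(T^*_𝓜 ⊗ End(E))`. -/
def cocycles (E : DGVectorBundle.{u, v, w} 𝓜) (p : ℤ) : Submodule ℝ E.BilinFamily :=
  E.endForm p ⊓ LinearMap.ker (E.diff p)

/-- Coboundaries of degree `p` in `Γ(T^*_𝓜 ⊗ End(E))`. -/
def coboundaries (E : DGVectorBundle.{u, v, w} 𝓜) (p : ℤ) : Submodule ℝ E.BilinFamily :=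
  (E.endForm (p - 1)).map (E.diff (p - 1))

/-- The cohomology `H^p(Γ(T^*_𝓜 ⊗ End(E)))`. -/
abbrev Cohomology (E : DGVectorBundle.{u, v, w} 𝓜) (p : ℤ) : Type (max v w) :=
  E.cocycles p ⧸ (E.coboundaries p).comap (E.cocycles p).subtype


theorem diff_apply (E : DGVectorBundle.{u, v, w} 𝓜) (p : ℤ) (α : E.BilinFamily) (d : ℤ)
    (X : 𝓜.vectorField d) (e : E.Sec) :
    E.diff p α d X e = E.QE (α d X e)
      - (-1 : ℝ) ^ p • α (1 + d) (GradedManifold.bracket 𝓜.Q d X) e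
      - (-1 : ℝ) ^ (p + d) • α d X (E.QE e) := rfl

theorem Q_Q (𝓜 : DGManifold.{u, v} n M) (f : 𝓜.Fn) : 𝓜.Q.1 (𝓜.Q.1 f) = 0 := by
  have h := congrArg (fun Y : 𝓜.vectorField (1 + 1) => Y.1 f) 𝓜.bracket_self
  have h2 : (2 : ℝ) • 𝓜.Q.1 (𝓜.Q.1 f) = 0 := by
    simpa [GradedManifold.bracket, two_smul] using h
  exact (smul_eq_zero.1 h2).resolve_left two_ne_zero

theorem bracket_bracket (𝓜 : DGManifold.{u, v} n M) (d : ℤ) (X : 𝓜.vectorField d) :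
    GradedManifold.bracket 𝓜.Q (1 + d) (GradedManifold.bracket 𝓜.Q d X) = 0 := by
  apply Subtype.ext
  ext f
  simp [GradedManifold.bracket, Q_Q, sign_add]

theorem diff_diff (E : DGVectorBundle.{u, v, w} 𝓜) (p : ℤ) (α : E.BilinFamily) :
    E.diff (p + 1) (E.diff p α) = 0 := by
  funext d; ext X e
  simp only [diff_apply, bracket_bracket, E.QE_QE, map_sub, map_smul, sign_add, zpow_one,
    Pi.zero_apply, LinearMap.zero_apply, map_zero]
  module

theorem congr_index (E : DGVectorBundle.{u, v, w} 𝓜) (α : E.BilinFamily) {d d' : ℤ} (h : d = d')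
    (X : 𝓜.vectorField d) (Y : 𝓜.vectorField d') (hXY : X.1 = Y.1) : α d X = α d' Y := by
  subst h
  rw [Subtype.ext hXY]

theorem apply_bracket_smulVF (E : DGVectorBundle.{u, v, w} 𝓜) (α : E.BilinFamily) (i d : ℤ)
    (f : 𝓜.Fn) (hf : f ∈ 𝓜.fnDeg i) (X : 𝓜.vectorField d) :
    α (1 + (i + d)) (GradedManifold.bracket 𝓜.Q (i + d) (GradedManifold.smulVF hf X)) =
      α (1 + i + d) (GradedManifold.smulVF (𝓜.Q.2.1 i f hf) X) +
        (-1 : ℝ) ^ i • α (i + (1 + d))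
          (GradedManifold.smulVF hf (GradedManifold.bracket 𝓜.Q d X)) := by
  have e1 : 1 + i + d = 1 + (i + d) := by ring
  have e2 : i + (1 + d) = 1 + (i + d) := by ring
  have h1 : ((GradedManifold.smulVF (𝓜.Q.2.1 i f hf) X).1 : Module.End ℝ 𝓜.Fn) ∈
      𝓜.vectorField (1 + (i + d)) := e1 ▸ (GradedManifold.smulVF (𝓜.Q.2.1 i f hf) X).2
  have h2 : ((GradedManifold.smulVF hf (GradedManifold.bracket 𝓜.Q d X)).1 :
      Module.End ℝ 𝓜.Fn) ∈ 𝓜.vectorField (1 + (i + d)) :=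
    e2 ▸ (GradedManifold.smulVF hf (GradedManifold.bracket 𝓜.Q d X)).2
  rw [E.congr_index α e1 _ ⟨_, h1⟩ rfl, E.congr_index α e2 _ ⟨_, h2⟩ rfl, ← map_smul, ← map_add]
  congr 1
  apply Subtype.ext
  ext g
  have := 𝓜.Q.2.2 i f (X.1 g) hf
  simp [GradedManifold.bracket, GradedManifold.smulVF, this, sign_add, mul_sub, smul_sub,
    smul_smul]
  abel

/-- The Atiyah cocycle `At^∇` of a linear connection:
`At^∇(X, e) = Q_E(∇_X e) - ∇_{[Q, X]} e - (-1)^|X| ∇_X (Q_E e)`. -/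
def atiyahForm (E : DGVectorBundle.{u, v, w} 𝓜) (c : E.Connection) : E.BilinFamily :=
  fun d => LinearMap.mk₂ ℝ
    (fun X e => E.QE (c.nabla d X e) - c.nabla (1 + d) (GradedManifold.bracket 𝓜.Q d X) e
      - (-1 : ℝ) ^ d • c.nabla d X (E.QE e))
    (by intros; simp only [map_add, LinearMap.add_apply, smul_add]; abel)
    (by intros; simp only [map_smul, LinearMap.smul_apply]; module)
    (by intros; simp only [map_add, smul_add]; abel)
    (by intros; simp only [map_smul]; module)

theorem atiyahForm_apply (E : DGVectorBundle.{u, v, w} 𝓜) (c : E.Connection) (d : ℤ)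
    (X : 𝓜.vectorField d) (e : E.Sec) :
    E.atiyahForm c d X e = E.QE (c.nabla d X e)
      - c.nabla (1 + d) (GradedManifold.bracket 𝓜.Q d X) e
      - (-1 : ℝ) ^ d • c.nabla d X (E.QE e) := rfl

theorem atiyahForm_eq_diff (E : DGVectorBundle.{u, v, w} 𝓜) (c : E.Connection) :
    E.atiyahForm c = E.diff 0 c.nabla := by
  funext d; ext X e
  simp [diff_apply, atiyahForm_apply]

theorem QE_rsmul (E : DGVectorBundle.{u, v, w} 𝓜) (i : ℤ) (f : 𝓜.Fn) (hf : f ∈ 𝓜.fnDeg i)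
    (e : E.Sec) : E.QE (f • e) = 𝓜.Q.1 f • e + (-1 : ℝ) ^ i • (f • E.QE e) :=
  E.QE_smul i f hf e

theorem atiyahForm_mem (E : DGVectorBundle.{u, v, w} 𝓜) (c : E.Connection) :
    E.atiyahForm c ∈ E.cocycles 1 := by
  refine ⟨⟨fun d X k e he => ?_, fun d X i f hf e => ?_, fun d X i f hf e => ?_⟩, ?_⟩
  · rw [atiyahForm_apply]
    have h1 := E.QE_mem _ _ (c.nabla_mem d X k e he)
    have h2 := c.nabla_mem (1 + d) (GradedManifold.bracket 𝓜.Q d X) k e he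
    have h3 := c.nabla_mem d X _ _ (E.QE_mem k e he)
    rw [show d + k + 1 = 1 + d + k by ring] at h1
    rw [show d + (k + 1) = 1 + d + k by ring] at h3
    exact sub_mem (sub_mem h1 h2) (Submodule.smul_mem _ _ h3)
  · simp only [atiyahForm_apply, apply_bracket_smulVF, c.nabla_smulVF, LinearMap.add_apply,
      LinearMap.smul_apply, E.QE_rsmul i f hf, sign_add, one_mul, smul_sub, smul_comm f]
    generalize f • E.QE (c.nabla d X e) = a1
    generalize f • c.nabla d X (E.QE e) = a2
    generalize f • c.nabla (1 + d) (GradedManifold.bracket 𝓜.Q d X) e = a3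
    generalize 𝓜.Q.1 f • c.nabla d X e = a4
    module
  · simp only [atiyahForm_apply, c.leibniz _ _ i f hf, map_add, map_smul, E.QE_rsmul i f hf,
      E.QE_rsmul _ _ (X.2.1 i f hf), c.leibniz _ _ _ _ (𝓜.Q.2.1 i f hf), smul_sub, smul_add,
      smul_comm f]
    have e1 : ((GradedManifold.bracket 𝓜.Q d X).1 : Module.End ℝ 𝓜.Fn) f =
        𝓜.Q.1 (X.1 f) - (-1 : ℝ) ^ d • X.1 (𝓜.Q.1 f) := by
      simp [GradedManifold.bracket]
    have s := sign_mul_self d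
    simp only [e1, sub_smul, smul_assoc, add_mul, mul_add, sign_add, one_mul, mul_one, smul_smul,
      ← mul_assoc, s]
    generalize f • E.QE (c.nabla d X e) = a1
    generalize f • c.nabla d X (E.QE e) = a2
    generalize f • c.nabla (1 + d) (GradedManifold.bracket 𝓜.Q d X) e = a3
    generalize 𝓜.Q.1 f • c.nabla d X e = a4
    generalize X.1 f • E.QE e = a5
    generalize X.1 (𝓜.Q.1 f) • e = a6
    generalize 𝓜.Q.1 (X.1 f) • e = a7
    module
  · change E.diff 1 (E.atiyahForm c) = 0
    rw [atiyahForm_eq_diff]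
    exact E.diff_diff 0 c.nabla

/-- The class of the Atiyah cocycle of a linear connection; this is the Atiyah class of the dg
vector bundle, and it does not depend on the connection. -/
def atiyahClass (E : DGVectorBundle.{u, v, w} 𝓜) (c : E.Connection) : E.Cohomology 1 :=
  Submodule.Quotient.mk ⟨E.atiyahForm c, E.atiyahForm_mem c⟩

theorem atiyahClass_eq (E : DGVectorBundle.{u, v, w} 𝓜) (c c' : E.Connection) :
    E.atiyahClass c = E.atiyahClass c' := by
  refine (Submodule.Quotient.eq _).2 ⟨c.nabla - c'.nabla, ⟨fun d X k e he => ?_,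
    fun d X i f hf e => ?_, fun d X i f hf e => ?_⟩, ?_⟩
  · rw [show (1 : ℤ) - 1 + d + k = d + k by ring]
    exact sub_mem (c.nabla_mem d X k e he) (c'.nabla_mem d X k e he)
  · simp [c.nabla_smulVF, c'.nabla_smulVF, smul_sub]
  · simp only [Pi.sub_apply, LinearMap.sub_apply, c.leibniz d X i f hf, c'.leibniz d X i f hf,
      smul_sub, sub_self, zero_add]
    abel
  · change E.diff (1 - 1) _ = E.atiyahForm c - E.atiyahForm c'
    rw [sub_self, map_sub, atiyahForm_eq_diff, atiyahForm_eq_diff]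

end DGVectorBundle

/-! ### Morphisms and contractions -/

/-- A morphism of dg vector bundles over `𝓜`, given by its action on sections: a
`C^∞(𝓜)`-linear map of degree `0` that commutes with the operators `Q`. -/
structure DGHom {𝓜 : DGManifold.{u, v} n M} (E F : DGVectorBundle.{u, v, w} 𝓜) where
  map : E.Sec →ₗ[𝓜.Fn] F.Sec
  map_mem : ∀ (k : ℤ) (e : E.Sec), e ∈ E.secDeg k → map e ∈ F.secDeg k
  map_QE : ∀ e : E.Sec, map (E.QE e) = F.QE (map e)

/-- A contraction of dg vector bundles from `E` to `F`. The map `h` is a bundle map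
`E → E[-1]`, that is, a graded linear map of degree `-1` on sections. -/
structure Contraction {𝓜 : DGManifold.{u, v} n M} (E F : DGVectorBundle.{u, v, w} 𝓜) where
  φ : DGHom E F
  ψ : DGHom F E
  h : E.Sec →ₗ[ℝ] E.Sec
  h_mem : ∀ (k : ℤ) (e : E.Sec), e ∈ E.secDeg k → h e ∈ E.secDeg (k - 1)
  h_smul : ∀ (i : ℤ) (f : 𝓜.Fn), f ∈ 𝓜.fnDeg i → ∀ e : E.Sec,
    h (f • e) = (-1 : ℝ) ^ i • (f • h e)
  φ_ψ : ∀ v : F.Sec, φ.map (ψ.map v) = v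
  ψ_φ : ∀ e : E.Sec, ψ.map (φ.map e) = e + E.QE (h e) + h (E.QE e)
  h_h : ∀ e : E.Sec, h (h e) = 0
  φ_h : ∀ e : E.Sec, φ.map (h e) = 0
  h_ψ : ∀ v : F.Sec, h (ψ.map v) = 0

namespace DGHom

variable {𝓜 : DGManifold.{u, v} n M} {E F : DGVectorBundle.{u, v, w} 𝓜}

/-- The underlying real-linear map on sections. -/
abbrev lin (φ : DGHom E F) : E.Sec →ₗ[ℝ] F.Sec := φ.map.restrictScalars ℝ

/-- The map `id ⊗ (ψ^* ⊗ φ)`. Under `End(E) ≅ E^* ⊗ E`, the map `ψ^* ⊗ φ` sends an endomorphism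
`L` of `E` to the endomorphism `φ ∘ L ∘ ψ` of `F`, so `α` goes to `(X, v) ↦ φ(α(X, ψ v))`. -/
def idTensor (φ : DGHom E F) (ψ : DGHom F E) : E.BilinFamily →ₗ[ℝ] F.BilinFamily where
  toFun α d := LinearMap.mk₂ ℝ (fun X v => φ.lin (α d X (ψ.lin v)))
    (by intros; simp) (by intros; simp) (by intros; simp) (by intros; simp)
  map_add' α β := by funext d; ext X v; simp
  map_smul' c α := by funext d; ext X v; simp

theorem idTensor_apply (φ : DGHom E F) (ψ : DGHom F E) (α : E.BilinFamily) (d : ℤ)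
    (X : 𝓜.vectorField d) (v : F.Sec) :
    idTensor φ ψ α d X v = φ.map (α d X (ψ.map v)) := rfl

theorem map_rsmul (φ : DGHom E F) (c : ℝ) (e : E.Sec) : φ.map (c • e) = c • φ.map e :=
  φ.lin.map_smul c e

theorem idTensor_endForm (φ : DGHom E F) (ψ : DGHom F E) (p : ℤ) {α : E.BilinFamily}
    (hα : α ∈ E.endForm p) : idTensor φ ψ α ∈ F.endForm p := by
  obtain ⟨a1, a2, a3⟩ := hα
  refine ⟨fun d X k e he => φ.map_mem _ _ (a1 d X k _ (ψ.map_mem k e he)),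
    fun d X i f hf e => ?_, fun d X i f hf e => ?_⟩
  · rw [idTensor_apply, a2 d X i f hf, map_rsmul, map_smul, idTensor_apply]
  · rw [idTensor_apply, map_smul, a3 d X i f hf, map_rsmul, map_smul, idTensor_apply]

theorem idTensor_diff (φ : DGHom E F) (ψ : DGHom F E) (p : ℤ) (α : E.BilinFamily) :
    F.diff p (idTensor φ ψ α) = idTensor φ ψ (E.diff p α) := by
  funext d; ext X v
  simp only [DGVectorBundle.diff_apply, idTensor_apply, map_sub, map_rsmul, φ.map_QE, ψ.map_QE]

/-- The map `H^p(Γ(T^*_𝓜 ⊗ End(E))) → H^p(Γ(T^*_𝓜 ⊗ End(F)))` induced by `id ⊗ (ψ^* ⊗ φ)`. -/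
def cohomologyMap (φ : DGHom E F) (ψ : DGHom F E) (p : ℤ) :
    E.Cohomology p →ₗ[ℝ] F.Cohomology p :=
  Submodule.mapQ _ _
    ((idTensor φ ψ).restrict (p := E.cocycles p) (q := F.cocycles p) fun α hα =>
      ⟨idTensor_endForm φ ψ p hα.1, by
        have h : E.diff p α = 0 := hα.2
        change F.diff p _ = 0
        rw [idTensor_diff, h, map_zero]⟩)
    (by
      rintro ⟨α, hα⟩ ⟨β, hβ, h⟩
      refine ⟨idTensor φ ψ β, idTensor_endForm φ ψ _ hβ, ?_⟩
      rw [idTensor_diff, h]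
      rfl)

end DGHom

end

end DGGeom

end

/-!
The map `id ⊗ (φ^* ⊗ ψ)` in the opposite direction inverts `id ⊗ (ψ^* ⊗ φ)` in cohomology. One
composite is the identity already on forms, because `φ ψ = id`. The other one sends `α` to
`(X, e) ↦ π(α(X, π e))` with `π = ψ φ = id + [Q_E, h]`, so it differs from the identity by pre- and
post-composition with the graded commutator `[Q_E, h]`. On a cocycle each of these two is exact:
`[Q_E, h] ∘ α = D(h ∘ α)`, and `α ∘ [Q_E, h]` is `D` of `(X, e) ↦ (-1)^(p + |X|) α(X, h e)`
(`Contraction.diff_postH`, `Contraction.diff_preH`).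

For the Atiyah class, `(X, v) ↦ φ(∇_X (ψ v))` is a linear connection on `F` whenever `∇` is one on
`E`, again because `φ ψ = id`. Its Atiyah cocycle is the image of that of `∇`, as
`id ⊗ (ψ^* ⊗ φ)` commutes with `D`, and the Atiyah class does not depend on the connection.
-/

noncomputable section

namespace DGGeom

variable {n : ℕ} {M : Type u} [TopologicalSpace M] [ChartedSpace (EuclideanSpace ℝ (Fin n)) M]
  {𝓜 : DGManifold.{u, v} n M} {E F : DGVectorBundle.{u, v, w} 𝓜}

namespace DGHom

/-- The identity morphism. -/
protected def id (E : DGVectorBundle.{u, v, w} 𝓜) : DGHom E E where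
  map := LinearMap.id
  map_mem _ _ he := he
  map_QE _ := rfl

theorem id_map (e : E.Sec) : (DGHom.id E).map e = e := rfl

/-- The composite `ψ φ` of two morphisms. -/
protected def comp {G : DGVectorBundle.{u, v, w} 𝓜} (ψ : DGHom F G) (φ : DGHom E F) : DGHom E G where
  map := ψ.map ∘ₗ φ.map
  map_mem k e he := ψ.map_mem k _ (φ.map_mem k e he)
  map_QE e := by simp only [LinearMap.comp_apply, φ.map_QE, ψ.map_QE]

theorem comp_map {G : DGVectorBundle.{u, v, w} 𝓜} (ψ : DGHom F G) (φ : DGHom E F) (e : E.Sec) :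
    (ψ.comp φ).map e = ψ.map (φ.map e) := rfl

/-- The linear connection `(X, v) ↦ φ(∇_X (ψ v))` on `F`, for a linear connection `∇` on `E` and
morphisms with `φ ψ = id`. -/
def pushConnection (φ : DGHom E F) (ψ : DGHom F E) (hφψ : ∀ v, φ.map (ψ.map v) = v)
    (c : E.Connection) : F.Connection where
  nabla := idTensor φ ψ c.nabla
  nabla_mem d X k v hv := φ.map_mem _ _ (c.nabla_mem d X k _ (ψ.map_mem k v hv))
  nabla_smulVF d X i f hf v := by
    rw [idTensor_apply, c.nabla_smulVF, map_smul, idTensor_apply]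
  leibniz d X i f hf v := by
    rw [idTensor_apply, map_smul, c.leibniz d X i f hf, map_add, map_rsmul, map_smul, map_smul,
      hφψ, idTensor_apply]

theorem idTensor_mem_cocycles (φ : DGHom E F) (ψ : DGHom F E) (p : ℤ) {α : E.BilinFamily}
    (hα : α ∈ E.cocycles p) : idTensor φ ψ α ∈ F.cocycles p := by
  refine ⟨idTensor_endForm φ ψ p hα.1, ?_⟩
  have h : E.diff p α = 0 := hα.2
  change F.diff p _ = 0
  rw [idTensor_diff, h, map_zero]

theorem cohomologyMap_atiyahClass (φ : DGHom E F) (ψ : DGHom F E)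
    (hφψ : ∀ v, φ.map (ψ.map v) = v) (c : E.Connection) (c' : F.Connection) :
    cohomologyMap φ ψ 1 (E.atiyahClass c) = F.atiyahClass c' := by
  rw [F.atiyahClass_eq c' (pushConnection φ ψ hφψ c)]
  refine congrArg Submodule.Quotient.mk (Subtype.ext ?_)
  change idTensor φ ψ (E.atiyahForm c) = F.atiyahForm _
  rw [DGVectorBundle.atiyahForm_eq_diff, DGVectorBundle.atiyahForm_eq_diff]
  exact (idTensor_diff φ ψ 0 c.nabla).symm

end DGHom

namespace DGVectorBundle

/-- The cocycle condition, solved for `Q_E(α(X, e))`. -/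
theorem QE_apply_of_mem_cocycles {p : ℤ} {α : E.BilinFamily} (hα : α ∈ E.cocycles p) (d : ℤ)
    (X : 𝓜.vectorField d) (e : E.Sec) :
    E.QE (α d X e) = (-1 : ℝ) ^ p • α (1 + d) (GradedManifold.bracket 𝓜.Q d X) e
      + (-1 : ℝ) ^ (p + d) • α d X (E.QE e) := by
  have h0 : E.diff p α = 0 := hα.2
  have h : E.diff p α d X e = 0 := by rw [h0]; rfl
  rw [diff_apply, sub_sub, sub_eq_zero] at h
  exact h

end DGVectorBundle

theorem sign_sub_one (i : ℤ) : (-1 : ℝ) ^ (i - 1) = -(-1 : ℝ) ^ i := by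
  rw [sub_eq_add_neg, sign_add, sign_neg]; simp

namespace Contraction

variable (C : Contraction E F)

/-- Post-composition with `h`: the family `(X, e) ↦ h(α(X, e))`. -/
def postH (α : E.BilinFamily) : E.BilinFamily :=
  fun d => LinearMap.mk₂ ℝ (fun X e => C.h (α d X e))
    (by intros; simp) (by intros; simp) (by intros; simp) (by intros; simp)

theorem postH_apply (α : E.BilinFamily) (d : ℤ) (X : 𝓜.vectorField d) (e : E.Sec) :
    C.postH α d X e = C.h (α d X e) := rfl

/-- Signed pre-composition with `h`: the family `(X, e) ↦ (-1)^(p + |X|) α(X, h e)`. The sign makes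
it graded linear of degree `p - 1` when `α` has degree `p`. -/
def preH (p : ℤ) (α : E.BilinFamily) : E.BilinFamily :=
  fun d => LinearMap.mk₂ ℝ (fun X e => (-1 : ℝ) ^ (p + d) • α d X (C.h e))
    (by intros; simp only [map_add, LinearMap.add_apply, smul_add])
    (by intros; simp only [map_smul, LinearMap.smul_apply]; module)
    (by intros; simp only [map_add, smul_add])
    (by intros; simp only [map_smul]; module)

theorem preH_apply (p : ℤ) (α : E.BilinFamily) (d : ℤ) (X : 𝓜.vectorField d) (e : E.Sec) :
    C.preH p α d X e = (-1 : ℝ) ^ (p + d) • α d X (C.h e) := rfl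

theorem postH_mem_endForm {p : ℤ} {α : E.BilinFamily} (hα : α ∈ E.endForm p) :
    C.postH α ∈ E.endForm (p - 1) := by
  obtain ⟨a1, a2, a3⟩ := hα
  refine ⟨fun d X k e he => ?_, fun d X i f hf e => ?_, fun d X i f hf e => ?_⟩
  · have := C.h_mem _ _ (a1 d X k e he)
    rwa [show p + d + k - 1 = p - 1 + d + k by ring] at this
  · rw [postH_apply, a2 d X i f hf, map_smul, C.h_smul i f hf, postH_apply, smul_smul, ← sign_add,
      show (p - 1) * i = p * i + -i by ring, sign_add, sign_add, sign_neg]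
  · rw [postH_apply, a3 d X i f hf, map_smul, C.h_smul i f hf, postH_apply, smul_smul, ← sign_add,
      show (p - 1 + d) * i = (p + d) * i + -i by ring, sign_add, sign_add, sign_neg]

theorem preH_mem_endForm {p : ℤ} {α : E.BilinFamily} (hα : α ∈ E.endForm p) :
    C.preH p α ∈ E.endForm (p - 1) := by
  obtain ⟨a1, a2, a3⟩ := hα
  refine ⟨fun d X k e he => ?_, fun d X i f hf e => ?_, fun d X i f hf e => ?_⟩
  · have := Submodule.smul_mem _ ((-1 : ℝ) ^ (p + d)) (a1 d X _ _ (C.h_mem k e he))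
    rwa [show p + d + (k - 1) = p - 1 + d + k by ring] at this
  · rw [preH_apply, a2 d X i f hf, preH_apply, smul_comm f, smul_smul, smul_smul,
      show (p - 1) * i = p * i + -i by ring]
    simp only [sign_add, sign_neg]
    congr 1
    ring
  · rw [preH_apply, C.h_smul i f hf, map_smul, a3 d X i f hf, preH_apply, smul_comm f, smul_smul,
      smul_smul, smul_smul, show (p - 1 + d) * i = (p + d) * i + -i by ring]
    simp only [sign_add, sign_neg]
    congr 1
    ring

/-- `D(h ∘ α) = [Q_E, h] ∘ α` for a cocycle `α`. -/
theorem diff_postH {p : ℤ} {α : E.BilinFamily} (hα : α ∈ E.cocycles p) (d : ℤ)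
    (X : 𝓜.vectorField d) (e : E.Sec) :
    E.diff (p - 1) (C.postH α) d X e = E.QE (C.h (α d X e)) + C.h (E.QE (α d X e)) := by
  rw [DGVectorBundle.QE_apply_of_mem_cocycles hα, DGVectorBundle.diff_apply]
  simp only [postH_apply, map_add, map_smul, show p - 1 + d = p + d - 1 by ring, sign_sub_one]
  module

/-- `D` of the signed pre-composition of a cocycle `α` with `h` is `α ∘ [Q_E, h]`. -/
theorem diff_preH {p : ℤ} {α : E.BilinFamily} (hα : α ∈ E.cocycles p) (d : ℤ)
    (X : 𝓜.vectorField d) (e : E.Sec) :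
    E.diff (p - 1) (C.preH p α) d X e = α d X (E.QE (C.h e)) + α d X (C.h (E.QE e)) := by
  rw [DGVectorBundle.diff_apply]
  simp only [preH_apply, map_smul, DGVectorBundle.QE_apply_of_mem_cocycles hα,
    show p - 1 + d = p + d - 1 by ring, sign_sub_one, sign_add, zpow_one, smul_add, smul_smul]
  have s1 := sign_mul_self p
  have s2 := sign_mul_self d
  generalize (-1 : ℝ) ^ p = a at *
  generalize (-1 : ℝ) ^ d = b at *
  have s3 : a * b * (a * b) = 1 := by rw [mul_mul_mul_comm, s1, s2, one_mul]
  match_scalars <;> first | ring1 | linear_combination s3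

/-- On cocycles, the composite of `id ⊗ (ψ^* ⊗ φ)` with `id ⊗ (φ^* ⊗ ψ)` is homotopic to the
identity. -/
theorem idTensor_idTensor_sub_mem_coboundaries {p : ℤ} {α : E.BilinFamily}
    (hα : α ∈ E.cocycles p) :
    DGHom.idTensor C.ψ C.φ (DGHom.idTensor C.φ C.ψ α) - α ∈ E.coboundaries p := by
  -- With `π = ψ φ`, the form `α ∘ π` is again a cocycle, because `π` is a morphism of `E`; hence
  -- `π ∘ α ∘ π - α = [Q_E, h] ∘ (α ∘ π) + α ∘ [Q_E, h]` is a sum of two exact terms.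
  have hπ : DGHom.idTensor (.id E) (C.ψ.comp C.φ) α ∈ E.cocycles p :=
    DGHom.idTensor_mem_cocycles _ _ p hα
  refine ⟨_, add_mem (C.postH_mem_endForm hπ.1) (C.preH_mem_endForm hα.1), ?_⟩
  rw [map_add]
  funext d
  ext X e
  simp only [Pi.add_apply, Pi.sub_apply, LinearMap.add_apply, LinearMap.sub_apply,
    C.diff_postH hπ, C.diff_preH hα, DGHom.idTensor_apply, DGHom.id_map, DGHom.comp_map, C.ψ_φ,
    map_add]
  abel

theorem cohomologyMap_bijective (p : ℤ) :
    Function.Bijective (DGHom.cohomologyMap C.φ C.ψ p) := by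
  refine ⟨(injective_iff_map_eq_zero _).2 fun x hx => ?_, fun y => ?_⟩
  · obtain ⟨⟨α, hα⟩, rfl⟩ := Submodule.Quotient.mk_surjective _ x
    obtain ⟨β, hβ, hD⟩ := (Submodule.Quotient.mk_eq_zero _).1 hx
    change F.diff (p - 1) β = DGHom.idTensor C.φ C.ψ α at hD
    refine (Submodule.Quotient.mk_eq_zero _).2 ?_
    have h := C.idTensor_idTensor_sub_mem_coboundaries hα
    rw [← hD, ← DGHom.idTensor_diff] at h
    have h' : E.diff (p - 1) (DGHom.idTensor C.ψ C.φ β) ∈ E.coboundaries p :=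
      Submodule.mem_map_of_mem (DGHom.idTensor_endForm C.ψ C.φ _ hβ)
    simpa using sub_mem h' h
  · obtain ⟨⟨β, hβ⟩, rfl⟩ := Submodule.Quotient.mk_surjective _ y
    refine ⟨Submodule.Quotient.mk ⟨_, DGHom.idTensor_mem_cocycles C.ψ C.φ p hβ⟩, ?_⟩
    refine congrArg Submodule.Quotient.mk (Subtype.ext ?_)
    change DGHom.idTensor C.φ C.ψ (DGHom.idTensor C.ψ C.φ β) = β
    funext d
    ext X v
    simp only [DGHom.idTensor_apply, C.φ_ψ]

end Contraction

end DGGeom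

end

theorem mainTheorem9 {n : ℕ} {M : Type u} [TopologicalSpace M] [T2Space M]
    [SecondCountableTopology M] [ChartedSpace (EuclideanSpace ℝ (Fin n)) M]
    [IsManifold (𝓡 n) ∞ M] (𝓜 : DGGeom.DGManifold.{u, v} n M)
    (E F : DGGeom.DGVectorBundle.{u, v, w} 𝓜) (hE : E.IsBounded) (hF : F.IsBounded)
    (C : DGGeom.Contraction E F) :
    (∀ k : ℤ, Function.Bijective (DGGeom.DGHom.cohomologyMap C.φ C.ψ k)) ∧
      ∀ (nablaE : E.Connection) (nablaF : F.Connection),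
        DGGeom.DGHom.cohomologyMap C.φ C.ψ 1 (E.atiyahClass nablaE) = F.atiyahClass nablaF :=
  ⟨C.cohomologyMap_bijective, DGGeom.DGHom.cohomologyMap_atiyahClass C.φ C.ψ C.φ_ψ⟩
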